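/- \textbf{Conventions.} Graphs are finite and may have loops and parallel edges; an edge consists of two distinct half-edges, each incident on one vertex, and an edge is directed by choosing one of its half-edges as initial. A \emph{circuit} is a nonempty closed walk in which no half-edge occurs twice, regarded up to orientation and starting point. Let $F$ be a 4-regular graph (every vertex has four incident half-edges), with $c(F)$ connected components. An \emph{Euler system} of $F$ is a set containing precisely one Euler circuit of each connected component of $F$. If $C$ is an Euler system and $v\in V(F)$, the two circuits obtained by following a circuit of $C$ from $v$ to $v$ are the \emph{fundamental circuits} of $C$ at $v$. If $E$ is a set that contains exactly one edge of each component of $F$, a \emph{based set of oriented fundamental circuits} of $C$ is a set $\Gamma_E=\{C_\Gamma(v)\mid v\in V(F)\}$, where $C_\Gamma(v)$ is a fundamental circuit of $C$ at $v$, with an orientation, that contains no edge of $E$. A \emph{circuit partition} $P$ of $F$ is a partition of $E(F)$ into edge-disjoint circuits. Its \emph{single transitions} are the pairs $\{h,h'\}$ of half-edges at a vertex along which a circuit of $P$ passes through that vertex; each half-edge $h$ lies in exactly one single transition, denoted $\overline h$. The \emph{touch-graph} $Tch(P)$ has a vertex for each $\gamma\in P$ and an edge $e_v$ for each $v\in V(F)$;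 the two half-edges of $e_v$ are the two single transitions of $P$ at $v$, each incident on the circuit of $P$ that contains it. The \emph{shadow} $\overline W$ of a closed walk $W$ in $F$ is the closed walk in $Tch(P)$ in which, at each passage of $W$ through a vertex $v$, arriving along $h$ and leaving along $h'$ (including the passage through the initial vertex of $W$), one traverses $e_v$ from $\overline h$ to $\overline{h'}$ if $\overline h\ne\overline{h'}$, and stands still if $\overline h=\overline{h'}$. Let $D$ be a directed version of $Tch(P)$. For a walk $W$ in $Tch(P)$ let $z_D(W)$ be the vector indexed by the edges of $Tch(P)$ obtained by tallying $+1$ in the $e$ coordinate each time $W$ traverses $e$ in the $D$ direction, and $-1$ each time $W$ traverses $e$ against it. The \emph{cycle space} of $Tch(P)$ over a field $\mathbb F$ is the span over $\mathbb F$ of the vectors $z_D(W)$ of the closed walks $W$ in $Tch(P)$. Let $M_{\mathbb R,\Gamma_E}(C,P,D)$ be the $V(F)\times V(F)$ integer matrix whose $v$ row is $z_D(\overline{C_\Gamma(v)})$ (the column of $e_w$ being labeled by $w$); over a field $\mathbb F$ its entries are replaced by their images in $\mathbb F$. \textbf{Theorem.} Let $C$ be an Euler system of a 4-regular graph $F$,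 let $E$ contain exactly one edge of each component of $F$, and let $\Gamma_E$ be a based set of oriented fundamental circuits of $C$. Let $P$ be a circuit partition of $F$ and $D$ a directed version of $Tch(P)$. Then for every field $\mathbb F$, the row space of $M_{\mathbb R,\Gamma_E}(C,P,D)$ over $\mathbb F$ is equal to the cycle space of $Tch(P)$ over $\mathbb F$. Moreover the nullity of $M_{\mathbb R,\Gamma_E}(C,P,D)$ over $\mathbb F$ is equal to $|P|-c(F)$. -/

import Mathlib

/-- A graph, loops and parallel edges allowed, with vertices `V`, edges `E` and half-edges `H`.
Every half-edge is incident on one vertex, and every edge consists of two distinct half-edges. -/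
structure HalfEdgeGraph (V E H : Type*) where
  /-- the vertex on which a half-edge is incident -/
  vert : H → V
  /-- the edge to which a half-edge belongs -/
  edge : H → E
  ncard_edge : ∀ e, {h | edge h = e}.ncard = 2

namespace HalfEdgeGraph

variable {V E H : Type*} (G : HalfEdgeGraph V E H)

theorem exists_opp (h : H) : ∃ k, k ≠ h ∧ G.edge k = G.edge h := by
  obtain ⟨k, hk, hne⟩ := Set.exists_ne_of_one_lt_ncard
    (by rw [G.ncard_edge (G.edge h)]; norm_num : 1 < {k | G.edge k = G.edge h}.ncard) h
  exact ⟨k, hne, hk⟩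

/-- The other half-edge of the same edge. -/
noncomputable def opp (h : H) : H := (G.exists_opp h).choose

theorem opp_ne (h : H) : G.opp h ≠ h := (G.exists_opp h).choose_spec.1

theorem edge_opp (h : H) : G.edge (G.opp h) = G.edge h := (G.exists_opp h).choose_spec.2

theorem eq_or_eq_opp {h k : H} (e : G.edge k = G.edge h) : k = h ∨ k = G.opp h := by
  obtain ⟨x, y, -, hxy⟩ := Set.ncard_eq_two.1 (G.ncard_edge (G.edge h))
  have mem : ∀ z, G.edge z = G.edge h → z = x ∨ z = y := fun z hz => by
    have : z ∈ {k | G.edge k = G.edge h} := hz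
    rw [hxy] at this
    simpa using this
  have h1 := mem h rfl
  have h2 := mem _ (G.edge_opp h)
  have h3 := mem k e
  have h4 := G.opp_ne h
  grind

theorem opp_opp (h : H) : G.opp (G.opp h) = h := by
  rcases G.eq_or_eq_opp ((G.edge_opp (G.opp h)).trans (G.edge_opp h)) with e | e
  · exact e
  · exact absurd e (G.opp_ne _)

/-- Every vertex has exactly four incident half-edges. -/
def IsFourRegular : Prop := ∀ v, {h | G.vert h = v}.ncard = 4

/-- The simple graph on the same vertices in which two distinct vertices are adjacent
if and only if some edge joins them; it carries the connectivity of the graph. -/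
def underlying : SimpleGraph V :=
  SimpleGraph.fromRel fun u w => ∃ h, G.vert h = u ∧ G.vert (G.opp h) = w

/-- Connected components. -/
abbrev Component : Type _ := G.underlying.ConnectedComponent

/-- The component that contains a given half-edge. -/
def componentOf (h : H) : G.Component := G.underlying.connectedComponentMk (G.vert h)

/-! ### Walks, directed versions and the cycle space -/

/-- A closed walk, listed as the sequence of half-edges along which it leaves its successive
vertices: after leaving along `a` it arrives along `G.opp a`, and the next half-edge starts at the
vertex of `G.opp a`; cyclically, so that the walk returns to its start. The empty list is the
closed walk of length zero. -/
def IsClosedWalk (w : List H) : Prop :=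
  (w : Cycle H).Chain fun a b => G.vert (G.opp a) = G.vert b

/-- A directed version: one half-edge of each edge is distinguished as the initial one. -/
structure Direction where
  init : E → H
  edge_init : ∀ e, G.edge (init e) = e

open Classical in
/-- The vector `z_D(W)`: its `e` coordinate counts `+1` for each traversal of `e` in the direction
`D` and `-1` for each traversal of `e` against it. -/
noncomputable def tally (D : G.Direction) (R : Type*) [Ring R] (w : List H) : E → R := fun e =>
  (w.map fun h => if G.edge h = e then (if h = D.init e then (1 : R) else -1) else 0).sum

/-- The cycle space over `𝕜`: the span of the vectors of closed walks. -/
noncomputable def cycleSpace (D : G.Direction) (𝕜 : Type*) [Field 𝕜] : Submodule 𝕜 (E → 𝕜) :=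
  Submodule.span 𝕜 {x | ∃ w, G.IsClosedWalk w ∧ G.tally D 𝕜 w = x}

/-! ### Circuits -/

/-- A circuit with a chosen orientation and no preferred starting point, given as the cyclic
sequence of the half-edges along which it leaves its successive vertices. No half-edge occurs
twice in the circuit, neither as a leaving nor as an arriving half-edge. -/
@[ext]
structure OrientedCircuit where
  toCycle : Cycle H
  ne_nil : toCycle ≠ Cycle.nil
  nodup : toCycle.Nodup
  opp_notMem : ∀ h ∈ toCycle, G.opp h ∉ toCycle
  chain : toCycle.Chain fun a b => G.vert (G.opp a) = G.vert b

namespace OrientedCircuit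

variable {G}

theorem mem_reverse_map {c : Cycle H} {h : H} :
    h ∈ (c.map G.opp).reverse ↔ G.opp h ∈ c := by
  rw [Cycle.mem_reverse_iff, Cycle.mem_map]
  constructor
  · rintro ⟨a, ha, rfl⟩
    rwa [G.opp_opp]
  · exact fun hh => ⟨_, hh, G.opp_opp h⟩

/-- The same circuit with the opposite orientation. -/
noncomputable def reverse (c : G.OrientedCircuit) : G.OrientedCircuit where
  toCycle := (c.toCycle.map G.opp).reverse
  ne_nil := by
    have := c.ne_nil
    rcases c with ⟨c, h1, h2, h3, h4⟩
    induction c using Cycle.induction_on with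
    | nil => exact absurd rfl h1
    | cons a l _ => simp
  nodup := by
    rw [Cycle.nodup_reverse_iff]
    have h2 := c.nodup
    revert h2
    generalize c.toCycle = s
    induction s using Cycle.induction_on with
    | nil => intro _; exact Cycle.nodup_nil
    | cons a l _ =>
      intro h2
      rw [Cycle.nodup_coe_iff] at h2
      rw [Cycle.map_coe, Cycle.nodup_coe_iff]
      exact h2.map (Function.LeftInverse.injective G.opp_opp)
  opp_notMem := by
    intro h hh hh'
    rw [mem_reverse_map] at hh hh'
    exact c.opp_notMem _ hh hh'
  chain := by
    have h4 := c.chain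
    revert h4
    generalize c.toCycle = s
    induction s using Cycle.induction_on with
    | nil => intro _; exact Cycle.Chain.nil _
    | cons a l _ =>
      intro h4
      rw [Cycle.chain_coe_cons] at h4
      rw [Cycle.map_coe, Cycle.reverse_coe, List.map_cons, List.reverse_cons,
        ← Cycle.coe_cons_eq_coe_append, Cycle.chain_coe_cons]
      have : G.opp a :: ((List.map G.opp l).reverse ++ [G.opp a])
          = ((a :: (l ++ [a])).map G.opp).reverse := by simp
      rw [this, List.isChain_reverse, List.isChain_map]
      refine h4.imp fun x y hxy => ?_
      rw [G.opp_opp]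
      exact hxy.symm

@[simp]
theorem toCycle_reverse (c : G.OrientedCircuit) :
    c.reverse.toCycle = (c.toCycle.map G.opp).reverse := rfl

theorem mem_reverse {c : G.OrientedCircuit} {h : H} :
    h ∈ c.reverse.toCycle ↔ G.opp h ∈ c.toCycle := mem_reverse_map

theorem reverse_reverse (c : G.OrientedCircuit) : c.reverse.reverse = c := by
  ext1
  simp only [toCycle_reverse]
  generalize c.toCycle = s
  induction s using Cycle.induction_on with
  | nil => rfl
  | cons a l _ =>
    simp only [Cycle.map_coe, Cycle.reverse_coe, List.map_reverse, List.reverse_reverse,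
      List.map_map]
    congr 1
    exact List.map_id'' (fun x => G.opp_opp x) _

open Classical in
/-- `c.Passage h k`: at some vertex, `c` arrives along the half-edge `h` and then leaves along
the half-edge `k`. -/
def Passage (c : G.OrientedCircuit) (h k : H) : Prop :=
  ∃ hk : k ∈ c.toCycle, h = G.opp (c.toCycle.prev c.nodup k hk)

theorem exists_coe_eq {s : Cycle H} {k : H} (hk : k ∈ s) : ∃ l : List H, s = ↑(k :: l) := by
  induction s using Quotient.inductionOn' with
  | h m =>
    obtain ⟨x, y, rfl⟩ := List.append_of_mem (show k ∈ m from hk)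
    exact ⟨y ++ x, Cycle.coe_eq_coe.2 (List.isRotated_append (l := x) (l' := k :: y))⟩

open Classical in
theorem prev_coe_cons {k : H} {l : List H} (hn : (↑(k :: l) : Cycle H).Nodup)
    (hk : k ∈ (↑(k :: l) : Cycle H)) :
    Cycle.prev (↑(k :: l)) hn k hk = (k :: l).getLast (List.cons_ne_nil k l) :=
  List.prev_head_eq_getLast (k :: l) (List.cons_ne_nil k l)

theorem passage_iff {c : G.OrientedCircuit} {h k : H} :
    c.Passage h k ↔ ∃ l : List H,
      c.toCycle = ↑(k :: l) ∧ h = G.opp ((k :: l).getLast (List.cons_ne_nil k l)) := by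
  obtain ⟨s, h1, h2, h3, h4⟩ := c
  constructor
  · rintro ⟨hk, rfl⟩
    obtain ⟨l, rfl⟩ := exists_coe_eq hk
    exact ⟨l, rfl, congrArg G.opp (prev_coe_cons h2 hk)⟩
  · rintro ⟨l, hl, rfl⟩
    change s = _ at hl
    subst hl
    exact ⟨by simp, congrArg G.opp (prev_coe_cons h2 (by simp)).symm⟩

theorem Passage.mem {c : G.OrientedCircuit} {h k : H} (p : c.Passage h k) :
    k ∈ c.toCycle := p.1

open Classical in
theorem Passage.opp_mem {c : G.OrientedCircuit} {h k : H} (p : c.Passage h k) :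
    G.opp h ∈ c.toCycle := by
  obtain ⟨hk, rfl⟩ := p
  rw [G.opp_opp]
  exact Cycle.prev_mem _ _ _ _

theorem Passage.ne {c : G.OrientedCircuit} {h k : H} (p : c.Passage h k) : h ≠ k := by
  rintro rfl
  exact c.opp_notMem _ p.mem p.opp_mem

theorem Passage.vert_eq {c : G.OrientedCircuit} {h k : H} (p : c.Passage h k) :
    G.vert h = G.vert k := by
  obtain ⟨l, hl, rfl⟩ := passage_iff.1 p
  have := c.chain
  rw [hl, Cycle.chain_ne_nil _ (List.cons_ne_nil k l), List.isChain_cons_cons] at this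
  exact this.1

theorem Passage.reverse {c : G.OrientedCircuit} {h k : H} (p : c.Passage h k) :
    c.reverse.Passage k h := by
  obtain ⟨l, hl, rfl⟩ := passage_iff.1 p
  rw [passage_iff, toCycle_reverse, hl]
  rcases List.eq_nil_or_concat l with rfl | ⟨m, a, rfl⟩
  · exact ⟨[], by simp, by simp [G.opp_opp]⟩
  · refine ⟨(m.map G.opp).reverse ++ [G.opp k], ?_, ?_⟩
    · simp [Cycle.map_coe, Cycle.reverse_coe]
    · simp [G.opp_opp]

theorem Passage.left_unique {c : G.OrientedCircuit} {h h' k : H} (p : c.Passage h k)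
    (q : c.Passage h' k) : h = h' := by
  obtain ⟨_, rfl⟩ := p
  obtain ⟨_, rfl⟩ := q
  rfl

theorem exists_passage {c : G.OrientedCircuit} {k : H} (hk : k ∈ c.toCycle) :
    ∃ h, c.Passage h k := ⟨_, hk, rfl⟩

end OrientedCircuit

/-- Two oriented circuits are the same circuit if they differ at most in orientation. -/
instance circuitSetoid : Setoid G.OrientedCircuit where
  r c d := d = c ∨ d = c.reverse
  iseqv :=
    { refl := fun _ => Or.inl rfl
      symm := by
        rintro c d (rfl | rfl)
        · exact Or.inl rfl
        · exact Or.inr c.reverse_reverse.symm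
      trans := by
        rintro c d e (rfl | rfl) (rfl | rfl)
        · exact Or.inl rfl
        · exact Or.inr rfl
        · exact Or.inr rfl
        · exact Or.inl c.reverse_reverse }

/-- A circuit, regardless of orientation and starting point. -/
def Circuit : Type _ := Quotient G.circuitSetoid

variable {G}

/-- The circuit underlying an oriented circuit. -/
def OrientedCircuit.toCircuit (c : G.OrientedCircuit) : G.Circuit := Quotient.mk _ c

theorem OrientedCircuit.toCircuit_eq_iff {c d : G.OrientedCircuit} :
    c.toCircuit = d.toCircuit ↔ d = c ∨ d = c.reverse := Quotient.eq

theorem OrientedCircuit.toCircuit_reverse (c : G.OrientedCircuit) :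
    c.reverse.toCircuit = c.toCircuit :=
  (toCircuit_eq_iff.2 (Or.inr rfl)).symm

/-- The set of edges of a circuit. -/
def Circuit.edges (γ : G.Circuit) : Set E :=
  {e | ∃ c : G.OrientedCircuit, c.toCircuit = γ ∧ ∃ h ∈ c.toCycle, G.edge h = e}

theorem Circuit.edge_mem_edges {c : G.OrientedCircuit} {h : H} (hh : h ∈ c.toCycle) :
    G.edge h ∈ c.toCircuit.edges := ⟨c, rfl, h, hh, rfl⟩

variable (G)

/-! ### Euler systems and based sets of fundamental circuits -/

/-- `γ` is an Euler circuit of the component `K`: its edges are exactly the edges of `K`. -/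
def IsEulerCircuitOf (γ : G.Circuit) (K : G.Component) : Prop :=
  ∀ h, G.edge h ∈ γ.edges ↔ G.componentOf h = K

/-- An Euler system: a set containing precisely one Euler circuit of each component
(and nothing else). -/
def IsEulerSystem (C : Set G.Circuit) : Prop :=
  (∀ γ ∈ C, ∃ K, G.IsEulerCircuitOf γ K) ∧ ∀ K, ∃! γ, γ ∈ C ∧ G.IsEulerCircuitOf γ K

/-- `B` contains precisely one edge of each component. -/
def IsBaseEdgeSet (B : Set E) : Prop :=
  ∀ K : G.Component, ∃! e, e ∈ B ∧ ∃ h, G.edge h = e ∧ G.componentOf h = K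

/-- `l` is an oriented fundamental circuit of `C` at `v`, listed from `v`: a circuit of `C`, with
one of its orientations, consists of a part `l` and a part `l'`, each of which leads from `v`
to `v`. -/
def IsFundamentalCircuit (C : Set G.Circuit) (v : V) (l : List H) : Prop :=
  ∃ (c : G.OrientedCircuit) (l' : List H), c.toCircuit ∈ C ∧ c.toCycle = ↑(l ++ l') ∧
    l.head?.map G.vert = some v ∧ l'.head?.map G.vert = some v

/-- A set consisting of one oriented fundamental circuit `Γ v` of `C` at each vertex `v`, all of
which exclude every edge of `B`. -/
def IsBasedAt (C : Set G.Circuit) (B : Set E) (Γ : V → List H) : Prop :=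
  ∀ v, G.IsFundamentalCircuit C v (Γ v) ∧ ∀ h ∈ Γ v, G.edge h ∉ B

/-! ### Circuit partitions and touch-graphs -/

/-- A partition of the edge set into circuits. -/
structure CircuitPartition where
  circuits : Set G.Circuit
  existsUnique_mem : ∀ e : E, ∃! γ, γ ∈ circuits ∧ e ∈ γ.edges

namespace CircuitPartition

variable {G} (P : G.CircuitPartition)

theorem exists_oriented (h : H) :
    ∃ c : G.OrientedCircuit, c.toCircuit ∈ P.circuits ∧ h ∈ c.toCycle := by
  obtain ⟨_, ⟨hγ, c, rfl, k, hk, e⟩, -⟩ := P.existsUnique_mem (G.edge h)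
  rcases G.eq_or_eq_opp e.symm with rfl | rfl
  · exact ⟨c, hγ, hk⟩
  · refine ⟨c.reverse, by rwa [c.toCircuit_reverse], ?_⟩
    rwa [OrientedCircuit.mem_reverse, G.opp_opp]

theorem eq_of_mem {c d : G.OrientedCircuit} (hc : c.toCircuit ∈ P.circuits)
    (hd : d.toCircuit ∈ P.circuits) {h : H} (h1 : h ∈ c.toCycle) (h2 : h ∈ d.toCycle) :
    c = d := by
  have e := (P.existsUnique_mem (G.edge h)).unique ⟨hc, Circuit.edge_mem_edges h1⟩
    ⟨hd, Circuit.edge_mem_edges h2⟩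
  rcases OrientedCircuit.toCircuit_eq_iff.1 e with rfl | rfl
  · rfl
  · exact absurd (OrientedCircuit.mem_reverse.1 h2) (c.opp_notMem _ h1)

/-- `{h, k}` is a single transition of `P`: some circuit of `P` passes through a vertex along
`h` and `k`. -/
def Pairs (h k : H) : Prop :=
  ∃ c : G.OrientedCircuit, c.toCircuit ∈ P.circuits ∧ c.Passage h k

theorem exists_pairs (h : H) : ∃ k, P.Pairs h k := by
  obtain ⟨c, hc, hh⟩ := P.exists_oriented h
  obtain ⟨k, hk⟩ := OrientedCircuit.exists_passage hh
  exact ⟨k, c.reverse, by rwa [c.toCircuit_reverse], hk.reverse⟩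

variable {P} in
theorem Pairs.symm {h k : H} (p : P.Pairs h k) : P.Pairs k h := by
  obtain ⟨c, hc, q⟩ := p
  exact ⟨c.reverse, by rwa [c.toCircuit_reverse], q.reverse⟩

variable {P} in
theorem Pairs.unique {h k k' : H} (p : P.Pairs h k) (q : P.Pairs h k') : k = k' := by
  obtain ⟨c, hc, p'⟩ := p.symm
  obtain ⟨d, hd, q'⟩ := q.symm
  obtain rfl := P.eq_of_mem hc hd p'.mem q'.mem
  exact p'.left_unique q'

/-- The half-edge that forms a single transition of `P` together with `h`. -/
noncomputable def partner (h : H) : H := (P.exists_pairs h).choose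

theorem pairs_partner (h : H) : P.Pairs h (P.partner h) := (P.exists_pairs h).choose_spec

theorem pairs_iff {h k : H} : P.Pairs h k ↔ k = P.partner h :=
  ⟨fun p => p.unique (P.pairs_partner h), fun e => e ▸ P.pairs_partner h⟩

theorem partner_partner (h : H) : P.partner (P.partner h) = h :=
  (P.pairs_iff.1 (P.pairs_partner h).symm).symm

theorem partner_ne (h : H) : P.partner h ≠ h := by
  obtain ⟨c, -, p⟩ := P.pairs_partner h
  exact p.ne.symm

theorem vert_partner (h : H) : G.vert (P.partner h) = G.vert h := by
  obtain ⟨c, -, p⟩ := P.pairs_partner h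
  exact p.vert_eq.symm

/-- The circuit of `P` that includes the half-edge `h`. -/
noncomputable def circuitOf (h : H) : P.circuits :=
  ⟨(P.existsUnique_mem (G.edge h)).choose, (P.existsUnique_mem (G.edge h)).choose_spec.1.1⟩

theorem circuitOf_eq {γ : G.Circuit} (hγ : γ ∈ P.circuits) {h : H} (hh : G.edge h ∈ γ.edges) :
    P.circuitOf h = ⟨γ, hγ⟩ :=
  Subtype.ext ((P.existsUnique_mem (G.edge h)).choose_spec.2 γ ⟨hγ, hh⟩).symm

theorem circuitOf_opp (h : H) : P.circuitOf (G.opp h) = P.circuitOf h := by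
  obtain ⟨c, hc, hh⟩ := P.exists_oriented h
  have := Circuit.edge_mem_edges hh
  rw [P.circuitOf_eq hc this, P.circuitOf_eq hc (by rwa [G.edge_opp])]

theorem circuitOf_partner (h : H) : P.circuitOf (P.partner h) = P.circuitOf h := by
  obtain ⟨c, hc, p⟩ := P.pairs_partner h
  rw [P.circuitOf_eq hc (Circuit.edge_mem_edges p.mem), ← P.circuitOf_opp h,
    P.circuitOf_eq hc (Circuit.edge_mem_edges p.opp_mem)]

/-- Half-edges are identified if they form a single transition of `P`. -/
def pairSetoid : Setoid H where
  r h k := k = h ∨ P.Pairs h k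
  iseqv :=
    { refl := fun _ => Or.inl rfl
      symm := by
        rintro h k (rfl | p)
        · exact Or.inl rfl
        · exact Or.inr p.symm
      trans := by
        rintro h k l (rfl | p) (rfl | q)
        · exact Or.inl rfl
        · exact Or.inr q
        · exact Or.inr p
        · exact Or.inl (q.unique p.symm) }

/-- The half-edges of the touch-graph: the single transitions of `P`. -/
def TouchHalf : Type _ := Quotient P.pairSetoid

/-- The shadow of a half-edge in the touch-graph. -/
def proj (h : H) : P.TouchHalf := Quotient.mk _ h

theorem proj_eq_iff {h k : H} : P.proj h = P.proj k ↔ k = h ∨ k = P.partner h := by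
  rw [← P.pairs_iff]
  exact Quotient.eq

/-- The touch-graph of `P`. Its vertices are the circuits of `P`, and its edges are (indexed by)
the vertices of the four-regular graph; the shadow of a half-edge `h` is incident on the circuit of
`P` that includes `h`, and belongs to the edge of the vertex on which `h` is incident. -/
noncomputable def touchGraph (hG : G.IsFourRegular) :
    HalfEdgeGraph P.circuits V P.TouchHalf where
  vert := Quotient.lift P.circuitOf (by
    rintro h k (rfl | p)
    · rfl
    · rw [P.pairs_iff.1 p, P.circuitOf_partner])
  edge := Quotient.lift G.vert (by
    rintro h k (rfl | p)
    · rfl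
    · rw [P.pairs_iff.1 p, P.vert_partner])
  ncard_edge := by
    intro v
    have h4 := hG v
    have hfin : {h | G.vert h = v}.Finite := Set.finite_of_ncard_ne_zero (by omega)
    obtain ⟨a, ha⟩ := Set.nonempty_of_ncard_ne_zero (s := {h | G.vert h = v}) (by omega)
    change G.vert a = v at ha
    have hlt : ({a, P.partner a} : Set H).ncard < {h | G.vert h = v}.ncard := by
      rw [h4, Set.ncard_pair (P.partner_ne a).symm]; norm_num
    obtain ⟨b, hb, hb'⟩ := Set.exists_mem_notMem_of_ncard_lt_ncard hlt
    change G.vert b = v at hb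
    simp only [Set.mem_insert_iff, Set.mem_singleton_iff, not_or] at hb'
    have hpb : P.partner b ≠ a := fun e => hb'.2 (by rw [← e, P.partner_partner])
    have hpb' : P.partner b ≠ P.partner a := fun e => hb'.1 (by
      rw [← P.partner_partner b, e, P.partner_partner])
    have hsub : ({a, P.partner a, b, P.partner b} : Set H) ⊆ {h | G.vert h = v} := by
      rintro x (rfl | rfl | rfl | rfl)
      · exact ha
      · exact (P.vert_partner a).trans ha
      · exact hb
      · exact (P.vert_partner b).trans hb
    have hcard : ({a, P.partner a, b, P.partner b} : Set H).ncard = 4 := by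
      rw [Set.ncard_insert_of_notMem, Set.ncard_insert_of_notMem, Set.ncard_pair]
      · exact (P.partner_ne b).symm
      · simp only [Set.mem_insert_iff, Set.mem_singleton_iff, not_or]
        exact ⟨fun e => hb'.2 e.symm, hpb'.symm⟩
      · simp only [Set.mem_insert_iff, Set.mem_singleton_iff, not_or]
        exact ⟨(P.partner_ne a).symm, fun e => hb'.1 e.symm, hpb.symm⟩
    have heq := Set.eq_of_subset_of_ncard_le hsub (by omega) hfin
    rw [Set.ncard_eq_two]
    refine ⟨P.proj a, P.proj b, ?_, ?_⟩
    · rw [Ne, P.proj_eq_iff, not_or]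
      exact hb'
    · ext t
      obtain ⟨x, rfl⟩ : ∃ x, P.proj x = t := Quotient.exists_rep t
      have hx : x ∈ {h | G.vert h = v} ↔ x ∈ ({a, P.partner a, b, P.partner b} : Set H) := by
        rw [heq]
      simp only [Set.mem_insert_iff, Set.mem_singleton_iff, Set.mem_ofPred_eq] at hx ⊢
      change G.vert x = v ↔ _
      rw [hx, @eq_comm _ (P.proj x) (P.proj a), @eq_comm _ (P.proj x) (P.proj b),
        P.proj_eq_iff, P.proj_eq_iff, or_assoc]

@[simp]
theorem touchGraph_vert (hG : G.IsFourRegular) (h : H) :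
    (P.touchGraph hG).vert (P.proj h) = P.circuitOf h := rfl

@[simp]
theorem touchGraph_edge (hG : G.IsFourRegular) (h : H) :
    (P.touchGraph hG).edge (P.proj h) = G.vert h := rfl

open Classical in
/-- The shadow of a closed walk in the touch-graph. Whenever the walk, having left its previous
vertex along `a`, arrives at a vertex along `G.opp a` and leaves it along `b` (cyclically, so
that the passage through the first vertex of the walk is also counted), the shadow traverses the
edge formed by the shadows of `G.opp a` and `b`, unless these two half-edges form a single
transition of `P`, in which case the shadow stands still. -/
noncomputable def shadow (w : List H) : List P.TouchHalf :=
  (w.zip (w.rotate 1)).filterMap fun p =>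
    if P.Pairs (G.opp p.1) p.2 then none else some (P.proj (G.opp p.1))

/-- The integer matrix whose `v` row is the vector in `ℤ ^ V` of the shadow of the oriented
fundamental circuit `Γ v`. -/
noncomputable def circuitMatrix (hG : G.IsFourRegular) (D : (P.touchGraph hG).Direction)
    (Γ : V → List H) : Matrix V V ℤ :=
  Matrix.of fun v => (P.touchGraph hG).tally D ℤ (P.shadow (Γ v))

end CircuitPartition

end HalfEdgeGraph

/-! ### Lists and cycles -/

/-! Over any field, a vector orthogonal to the kernel of a matrix lies in its row space
(`Matrix.mem_span_range_row`), so everything follows once the kernel is identified with the space of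
coboundaries of the touch-graph. The rows are vectors of closed walks, and closed walks are
orthogonal to coboundaries; this gives one inclusion of the kernel and both inclusions of the row
space. The coboundaries have dimension |P| - c(F), because a function on P has zero coboundary
exactly when it is constant on the components of F.

The substance is that a kernel vector x is a coboundary (`exists_coboundary_eq`). Give each
half-edge at v the `level` 0 or x v, according to its single transition. Pairing x with the shadow
of W then gives the sum over W of τ h = level h - level (opp h) (`sum_tally_shadow_mul`). As τ adds
up to zero along each fundamental circuit, its partial sums along an Euler circuit, cut open at the
base edge, agree at both visits to a vertex. They define a potential p on V whose differences are τ
off the base edges (`IsBasedAt.exists_potential`). Hence level + p is preserved by all single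
transitions and all non-base edges. A circuit of P contains at most one base edge, and telescoping
around the circuit settles that edge too (`apply_opp_eq_of_base`). So level + p descends to P, and
its coboundary is x. -/

theorem List.IsChain.sum_map_eq {α M : Type*} [AddCommMonoid M] {φ ψ : α → M} :
    ∀ {l : List α} {a b : α}, List.IsChain (fun x y => φ x = ψ y) (a :: (l ++ [b])) →
      ((a :: l).map φ).sum = ((l ++ [b]).map ψ).sum
  | [], a, b, h => by simpa using h
  | c :: l, a, b, h => by
    rw [List.cons_append, List.isChain_cons_cons] at h
    rw [List.map_cons, List.sum_cons, sum_map_eq h.2, h.1]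
    simp

/-- Telescoping around a closed chain. -/
theorem Cycle.Chain.sum_map_eq {α M : Type*} [AddCommMonoid M] {φ ψ : α → M} {w : List α}
    (h : (w : Cycle α).Chain fun x y => φ x = ψ y) : (w.map φ).sum = (w.map ψ).sum := by
  cases w with
  | nil => rfl
  | cons a l =>
    rw [List.IsChain.sum_map_eq ((Cycle.chain_coe_cons _ _ _).1 h)]
    simp [add_comm]

theorem List.sum_map_sub_eq {α M : Type*} [AddCommGroup M] (φ ψ : α → M) (w : List α) :
    (w.map fun a => φ a - ψ a).sum = (w.map φ).sum - (w.map ψ).sum := by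
  induction w with
  | nil => simp
  | cons a w ih => simp only [List.map_cons, List.sum_cons, ih]; abel

theorem Cycle.exists_eq_coe_cons {α : Type*} {s : Cycle α} (hs : s ≠ Cycle.nil) :
    ∃ (a : α) (l : List α), s = ((a :: l : List α) : Cycle α) := by
  induction s using Quotient.inductionOn' with
  | h m =>
    cases m with
    | nil => exact absurd rfl hs
    | cons a l => exact ⟨a, l, rfl⟩

/-- The head occurs at one position only, so a rotation that keeps it in front is trivial. Cutting a
circuit at a fixed half-edge thus yields a well-defined list. -/
theorem List.eq_of_isRotated_cons {α : Type*} {a : α} {l l' : List α} (h : (a :: l) ~r (a :: l'))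
    (hn : (a :: l).Nodup) : l = l' := by
  obtain ⟨n, hn', h⟩ := List.isRotated_iff_mod.1 h
  rcases hn'.lt_or_eq with hlt | rfl
  · have h0 := List.head?_rotate hlt
    rw [h, List.head?_cons, eq_comm, List.getElem?_eq_some_iff] at h0
    obtain ⟨_, h0⟩ := h0
    have : n = 0 := (hn.getElem_inj_iff (hi := hlt) (hj := by simp)).1 (by simpa using h0)
    subst this
    simpa using h
  · rw [List.rotate_length] at h
    simpa using h

theorem List.takeWhile_ne_eq_of_append {α : Type*} [DecidableEq α] {a : α} {l l' : List α}
    (h : a ∉ l) : (l ++ a :: l').takeWhile (fun x => x ≠ a) = l := by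
  induction l with
  | nil => simp
  | cons b l ih =>
    rw [List.mem_cons, not_or] at h
    rw [List.cons_append, List.takeWhile_cons_of_pos (by simpa using Ne.symm h.1), ih h.2]

namespace HalfEdgeGraph

/-! ### Tallies of walks -/

section Tally

variable {V E H : Type*} {G : HalfEdgeGraph V E H}

open Classical in
theorem sum_tally_mul [Fintype E] (D : G.Direction) {R : Type*} [CommRing R] (x : E → R)
    (w : List H) : ∑ e, G.tally D R w e * x e =
      (w.map fun h => if h = D.init (G.edge h) then x (G.edge h) else -x (G.edge h)).sum := by
  induction w with
  | nil => simp [tally]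
  | cons a w ih =>
    rw [List.map_cons, List.sum_cons, ← ih]
    simp only [tally, List.map_cons, List.sum_cons, add_mul, Finset.sum_add_distrib]
    congr 1
    rw [Finset.sum_eq_single (G.edge a)]
    · simp
    · intro e _ he
      simp [he.symm]
    · simp

theorem intCast_tally (D : G.Direction) (R : Type*) [Ring R] (w : List H) (e : E) :
    ((G.tally D ℤ w e : ℤ) : R) = G.tally D R w e := by
  simp only [tally]
  induction w with
  | nil => simp
  | cons a w ih =>
    simp only [List.map_cons, List.sum_cons, Int.cast_add, ih]
    split_ifs <;> simp

/-- The coboundary of a function on the vertices. -/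
noncomputable def coboundary (D : G.Direction) (R : Type*) [Ring R] : (V → R) →ₗ[R] E → R where
  toFun f e := f (G.vert (G.opp (D.init e))) - f (G.vert (D.init e))
  map_add' f g := by ext e; simp only [Pi.add_apply]; abel
  map_smul' r f := by ext e; simp [mul_sub]

open Classical in
-- Going against `D` changes the sign and also exchanges the two ends, so the signed value is always
-- head minus tail.
theorem coboundary_edge (D : G.Direction) {R : Type*} [Ring R] (f : V → R) (h : H) :
    (if h = D.init (G.edge h) then coboundary D R f (G.edge h)
      else -coboundary D R f (G.edge h)) = f (G.vert (G.opp h)) - f (G.vert h) := by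
  change (if _ then f _ - f _ else -(f _ - f _)) = _
  rcases G.eq_or_eq_opp (D.edge_init (G.edge h)) with e | e
  · simp [e]
  · rw [e, G.opp_opp, if_neg (G.opp_ne h).symm, neg_sub]

theorem IsClosedWalk.sum_tally_mul_coboundary [Fintype E] {w : List H} (hw : G.IsClosedWalk w)
    (D : G.Direction) {R : Type*} [CommRing R] (f : V → R) :
    ∑ e, G.tally D R w e * coboundary D R f e = 0 := by
  classical
  rw [sum_tally_mul]
  simp only [coboundary_edge]
  have := Cycle.Chain.sum_map_eq (φ := fun h => f (G.vert (G.opp h)))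
    (ψ := fun h => f (G.vert h)) (hw.imp fun a b e => congrArg f e)
  rw [List.sum_map_sub_eq, this, sub_self]

end Tally

/-! ### Circuits -/

section Circuits

variable {V E H : Type*} {G : HalfEdgeGraph V E H}

theorem componentOf_eq_of_vert_eq {h k : H} (e : G.vert h = G.vert k) :
    G.componentOf h = G.componentOf k := by
  rw [componentOf, e, componentOf]

theorem componentOf_opp (h : H) : G.componentOf (G.opp h) = G.componentOf h := by
  by_cases e : G.vert (G.opp h) = G.vert h
  · exact componentOf_eq_of_vert_eq e
  · refine SimpleGraph.ConnectedComponent.connectedComponentMk_eq_of_adj ?_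
    rw [underlying, SimpleGraph.fromRel_adj]
    exact ⟨e, Or.inr ⟨h, rfl, rfl⟩⟩

/-- A function on the vertices that is constant on the edges is constant on the components. -/
theorem eq_of_componentMk_eq {α : Type*} {f : V → α}
    (hf : ∀ h, f (G.vert (G.opp h)) = f (G.vert h)) {u v : V}
    (huv : G.underlying.connectedComponentMk u = G.underlying.connectedComponentMk v) :
    f u = f v := by
  obtain ⟨p⟩ := SimpleGraph.ConnectedComponent.exact huv
  induction p with
  | nil => rfl
  | cons hadj _ ih =>
    rw [← ih (SimpleGraph.ConnectedComponent.sound ⟨by assumption⟩)]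
    rw [underlying, SimpleGraph.fromRel_adj] at hadj
    obtain ⟨-, ⟨h, rfl, rfl⟩ | ⟨h, rfl, rfl⟩⟩ := hadj
    · exact (hf h).symm
    · exact hf h

theorem IsFourRegular.finite_half [Finite V] (hG : G.IsFourRegular) : Finite H := by
  refine Set.finite_univ_iff.1 ?_
  have : (Set.univ : Set H) = ⋃ v, {h | G.vert h = v} := by ext; simp
  rw [this]
  exact Set.finite_iUnion fun v => Set.finite_of_ncard_ne_zero (by rw [hG v]; norm_num)

theorem IsFourRegular.exists_vert_eq (hG : G.IsFourRegular) (v : V) : ∃ h, G.vert h = v :=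
  Set.nonempty_of_ncard_ne_zero (s := {h | G.vert h = v}) (by rw [hG v]; norm_num)

namespace OrientedCircuit

theorem mem_or_opp_mem_of_edge_mem {c : G.OrientedCircuit} {h : H}
    (hh : G.edge h ∈ c.toCircuit.edges) : h ∈ c.toCycle ∨ G.opp h ∈ c.toCycle := by
  obtain ⟨d, hd, k, hk, e⟩ := hh
  rcases toCircuit_eq_iff.1 hd with rfl | rfl
  · rcases G.eq_or_eq_opp e with rfl | rfl
    · exact Or.inl hk
    · exact Or.inr hk
  · rw [mem_reverse, mem_reverse, G.opp_opp]
    rcases G.eq_or_eq_opp e with rfl | rfl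
    · exact Or.inr hk
    · exact Or.inl hk

theorem chain_passage (c : G.OrientedCircuit) :
    c.toCycle.Chain fun a b => c.Passage (G.opp a) b := by
  obtain ⟨h, l, e⟩ := Cycle.exists_eq_coe_cons c.ne_nil
  rw [e, Cycle.chain_coe_cons, List.isChain_iff_forall_rel_of_append_cons_cons]
  intro a b s t hst
  rw [passage_iff, e]
  -- An empty `t` means the closing pair, with `b` the initial half-edge; otherwise the circuit is
  -- rotated to start at `b`, which puts `a` last.
  rcases List.eq_nil_or_concat t with rfl | ⟨t', z, rfl⟩
  · have h1 : (h :: l) ++ [h] = (s ++ [a]) ++ [b] := by simpa using hst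
    obtain ⟨h2, h3⟩ := List.append_inj' h1 rfl
    obtain rfl : h = b := by simpa using h3
    exact ⟨l, rfl, by simp [h2]⟩
  · have h1 : (h :: l) ++ [h] = (s ++ a :: b :: t') ++ [z] := by simpa using hst
    obtain ⟨h2, h3⟩ := List.append_inj' h1 rfl
    refine ⟨t' ++ s ++ [a], ?_, by simp⟩
    rw [h2, Cycle.coe_eq_coe]
    simpa using List.isRotated_append (l := s ++ [a]) (l' := b :: t')

end OrientedCircuit

namespace CircuitPartition

variable (P : G.CircuitPartition)

theorem pairs_chain {c : G.OrientedCircuit} (hc : c.toCircuit ∈ P.circuits) :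
    c.toCycle.Chain fun a b => b = P.partner (G.opp a) :=
  c.chain_passage.imp fun _ _ p => P.pairs_iff.1 ⟨c, hc, p⟩

theorem circuitOf_surjective : Function.Surjective P.circuitOf := by
  rintro ⟨γ, hγ⟩
  obtain ⟨c, rfl⟩ : ∃ c : G.OrientedCircuit, c.toCircuit = γ := Quotient.exists_rep γ
  obtain ⟨h, l, e⟩ := Cycle.exists_eq_coe_cons c.ne_nil
  exact ⟨h, P.circuitOf_eq hγ (Circuit.edge_mem_edges (by simp [e]))⟩

/-- A function on the half-edges that agrees on edges and on single transitions is constant on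
the circuits of the partition. -/
theorem eq_of_circuitOf_eq {α : Type*} {g : H → α} (h1 : ∀ h, g (G.opp h) = g h)
    (h2 : ∀ h, g (P.partner h) = g h) {h k : H} (hk : P.circuitOf h = P.circuitOf k) :
    g h = g k := by
  obtain ⟨c, hc, hh⟩ := P.exists_oriented h
  have hk' : k ∈ c.toCycle ∨ G.opp k ∈ c.toCycle := by
    apply OrientedCircuit.mem_or_opp_mem_of_edge_mem
    rw [P.circuitOf_eq hc (Circuit.edge_mem_edges hh)] at hk
    have hk' : c.toCircuit = P.circuitOf k := congrArg Subtype.val hk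
    rw [hk']
    exact (P.existsUnique_mem (G.edge k)).choose_spec.1.2
  -- For a transitive relation, a cyclic chain relates any two members of the cycle.
  have : IsTrans H fun a b => g a = g b := ⟨fun _ _ _ => Eq.trans⟩
  have hch := Cycle.chain_iff_pairwise.1 ((P.pairs_chain hc).imp
    (r₂ := fun a b => g a = g b) fun a b e => by rw [e, h2, h1])
  rcases hk' with hk' | hk'
  · exact hch _ hh _ hk'
  · rw [← h1 k]
    exact hch _ hh _ hk'

end CircuitPartition

end Circuits

/-! ### Shadows -/

section Shadow

variable {V E H : Type*}

/-- A list of half-edges traces a walk from one vertex to another. -/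
def IsWalkFrom (G : HalfEdgeGraph V E H) : List H → V → V → Prop
  | [], u, v => u = v
  | h :: l, u, v => G.vert h = u ∧ G.IsWalkFrom l (G.vert (G.opp h)) v

variable {G : HalfEdgeGraph V E H}

theorem IsWalkFrom.isChain {l : List H} {x y : H}
    (hl : G.IsWalkFrom l (G.vert (G.opp y)) (G.vert x)) :
    List.IsChain (fun a b => G.vert (G.opp a) = G.vert b) (y :: (l ++ [x])) := by
  induction l generalizing y with
  | nil => exact List.isChain_pair.2 hl
  | cons a l ih => exact List.isChain_cons_cons.2 ⟨hl.1.symm, ih hl.2⟩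

theorem IsWalkFrom.isClosedWalk {l : List H} {v : V} (hl : G.IsWalkFrom l v v) :
    G.IsClosedWalk l := by
  cases l with
  | nil => trivial
  | cons a l =>
    obtain ⟨rfl, hl⟩ := hl
    exact hl.isChain

namespace CircuitPartition

variable (P : G.CircuitPartition) (hG : G.IsFourRegular)

theorem touchGraph_opp_proj {h k : H} (hv : G.vert h = G.vert k) (hn : ¬ P.Pairs h k) (hne : h ≠ k) :
    (P.touchGraph hG).opp (P.proj h) = P.proj k := by
  rcases (P.touchGraph hG).eq_or_eq_opp (h := P.proj h) (k := P.proj k) hv.symm with e | e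
  · rw [eq_comm, P.proj_eq_iff, ← P.pairs_iff] at e
    rcases e with e | e
    · exact absurd e.symm hne
    · exact absurd e hn
  · exact e.symm

open Classical in
/-- The list of traversed edges of the touch-graph along a list of passages. -/
noncomputable def shadowList (w w' : List H) : List P.TouchHalf :=
  (w.zip w').filterMap fun p =>
    if P.Pairs (G.opp p.1) p.2 then none else some (P.proj (G.opp p.1))

/-- The closing half-edge becomes a separate endpoint, which inductions on `l` can keep fixed. -/
theorem shadow_cons (a : H) (l : List H) : P.shadow (a :: l) = P.shadowList (a :: l) (l ++ [a]) := by
  simp [shadow, shadowList]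

theorem shadowList_of_pairs {a b : H} {l l' : List H} (h : P.Pairs (G.opp a) b) :
    P.shadowList (a :: l) (b :: l') = P.shadowList l l' := by
  simp [shadowList, h]

theorem shadowList_of_not_pairs {a b : H} {l l' : List H} (h : ¬ P.Pairs (G.opp a) b) :
    P.shadowList (a :: l) (b :: l') = P.proj (G.opp a) :: P.shadowList l l' := by
  simp [shadowList, h]

/-- The shadow always stands at the circuit of P containing the current half-edge: edges and single
transitions preserve that circuit, and any other passage crosses to the other end of the touch-graph
edge. Backtracking has to be excluded, since a half-edge is not paired with itself and `shadowList`
would record a traversal. -/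
theorem shadowList_isWalkFrom {a b : H} {l : List H}
    (hw : List.IsChain (fun x y => G.vert (G.opp x) = G.vert y ∧ G.opp x ≠ y) (a :: (l ++ [b]))) :
    (P.touchGraph hG).IsWalkFrom (P.shadowList (a :: l) (l ++ [b])) (P.circuitOf a)
      (P.circuitOf b) := by
  have key : ∀ {a b : H} {l l' : List H} {γ : P.circuits},
      (G.vert (G.opp a) = G.vert b ∧ G.opp a ≠ b) →
      (P.touchGraph hG).IsWalkFrom (P.shadowList l l') (P.circuitOf b) γ →
      (P.touchGraph hG).IsWalkFrom (P.shadowList (a :: l) (b :: l')) (P.circuitOf a) γ := by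
    intro a b l l' γ hab hl
    by_cases hp : P.Pairs (G.opp a) b
    · rw [P.shadowList_of_pairs hp, ← P.circuitOf_opp a, ← P.circuitOf_partner (G.opp a),
        ← P.pairs_iff.1 hp]
      exact hl
    · rw [P.shadowList_of_not_pairs hp]
      refine ⟨P.circuitOf_opp a, ?_⟩
      rw [P.touchGraph_opp_proj hG hab.1 hp hab.2]
      exact hl
  induction l generalizing a with
  | nil => exact key (by simpa using hw) rfl
  | cons c l ih =>
    rw [List.cons_append, List.isChain_cons_cons] at hw
    exact key hw.1 (ih hw.2)

theorem isClosedWalk_shadow {w : List H}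
    (hw : (w : Cycle H).Chain fun x y => G.vert (G.opp x) = G.vert y ∧ G.opp x ≠ y) :
    (P.touchGraph hG).IsClosedWalk (P.shadow w) := by
  cases w with
  | nil => trivial
  | cons a l =>
    rw [shadow_cons]
    exact (P.shadowList_isWalkFrom hG hw).isClosedWalk

variable {R : Type*} [CommRing R]

open Classical in
/-- A local potential for `x` around each vertex: zero on the initial single transition and
`x v` on the other one. -/
noncomputable def level {hG : G.IsFourRegular} (D : (P.touchGraph hG).Direction) (x : V → R)
    (h : H) : R :=
  if P.proj h = D.init (G.vert h) then 0 else x (G.vert h)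

variable {hG} (D : (P.touchGraph hG).Direction) (x : V → R)

theorem level_partner (h : H) : P.level D x (P.partner h) = P.level D x h := by
  have : P.proj (P.partner h) = P.proj h := (P.proj_eq_iff.2 (Or.inr rfl)).symm
  rw [level, level, this, P.vert_partner]

open Classical in
theorem level_sub_level {h k : H} (hv : G.vert h = G.vert k) (hp : ¬ P.Pairs h k) (hne : h ≠ k) :
    P.level D x k - P.level D x h =
      if P.proj h = D.init (G.vert h) then x (G.vert h) else -x (G.vert h) := by
  have ho := P.touchGraph_opp_proj hG hv hp hne
  rcases (P.touchGraph hG).eq_or_eq_opp (h := P.proj h) (D.edge_init (G.vert h)) with e | e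
  · have hk : P.proj k ≠ D.init (G.vert k) := by
      rw [← hv, e, ← ho]
      exact (P.touchGraph hG).opp_ne _
    rw [level, level, if_neg hk, if_pos e.symm, if_pos e.symm, hv, sub_zero]
  · have hk : P.proj k = D.init (G.vert k) := by rw [← hv, e, ho]
    have hh : P.proj h ≠ D.init (G.vert h) := by
      rw [e]
      exact ((P.touchGraph hG).opp_ne _).symm
    rw [level, level, if_pos hk, if_neg hh, if_neg hh, zero_sub]

open Classical in
-- Each passage from `opp a` to `b` contributes the change of level: none along a single transition,
-- and plus or minus `x v` when the shadow crosses the edge of `v`.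
theorem sum_shadowList {a b : H} {l : List H}
    (hw : List.IsChain (fun x y => G.vert (G.opp x) = G.vert y ∧ G.opp x ≠ y) (a :: (l ++ [b]))) :
    ((P.shadowList (a :: l) (l ++ [b])).map fun h =>
      if h = D.init ((P.touchGraph hG).edge h) then x ((P.touchGraph hG).edge h)
      else -x ((P.touchGraph hG).edge h)).sum =
    ((l ++ [b]).map (P.level D x)).sum - ((a :: l).map fun h => P.level D x (G.opp h)).sum := by
  have key : ∀ {a b : H} {l l' : List H} {r s : R},
      (G.vert (G.opp a) = G.vert b ∧ G.opp a ≠ b) →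
      ((P.shadowList l l').map fun h =>
        if h = D.init ((P.touchGraph hG).edge h) then x ((P.touchGraph hG).edge h)
        else -x ((P.touchGraph hG).edge h)).sum = r - s →
      ((P.shadowList (a :: l) (b :: l')).map fun h =>
        if h = D.init ((P.touchGraph hG).edge h) then x ((P.touchGraph hG).edge h)
        else -x ((P.touchGraph hG).edge h)).sum =
        (P.level D x b + r) - (P.level D x (G.opp a) + s) := by
    intro a b l l' r s hab hl
    by_cases hp : P.Pairs (G.opp a) b
    · rw [P.shadowList_of_pairs hp, hl, P.pairs_iff.1 hp, P.level_partner]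
      ring
    · rw [P.shadowList_of_not_pairs hp, List.map_cons, List.sum_cons, hl, touchGraph_edge,
        ← P.level_sub_level D x hab.1 hp hab.2]
      ring
  induction l generalizing a with
  | nil =>
    have hw' : G.vert (G.opp a) = G.vert b ∧ G.opp a ≠ b := by simpa using hw
    have := key (l := []) (l' := []) (r := 0) (s := 0) hw' (by simp [shadowList])
    simpa using this
  | cons c l ih =>
    rw [List.cons_append, List.isChain_cons_cons] at hw
    simpa only [List.cons_append, List.map_cons, List.sum_cons] using key hw.1 (ih hw.2)

/-- The tally of a shadow is evaluated by the differences of levels along the edges. -/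
theorem sum_tally_shadow_mul [Fintype V] {w : List H}
    (hw : (w : Cycle H).Chain fun x y => G.vert (G.opp x) = G.vert y ∧ G.opp x ≠ y) :
    ∑ v, (P.touchGraph hG).tally D R (P.shadow w) v * x v =
      (w.map fun h => P.level D x h - P.level D x (G.opp h)).sum := by
  rw [sum_tally_mul]
  cases w with
  | nil => simp [shadow]
  | cons a l =>
    rw [shadow_cons]
    refine (P.sum_shadowList D x hw).trans ?_
    -- The sum over passages is regrouped as a sum over edges; for a closed walk the arriving list
    -- `l ++ [a]` only permutes `a :: l`.
    rw [List.sum_map_sub_eq]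
    simp [add_comm]

end CircuitPartition

end Shadow

/-! ### Potentials along Euler systems -/

section Euler

variable {V E H : Type*} {G : HalfEdgeGraph V E H}

/-- Each of the two parts into which two visits to a vertex split a circuit is closed. -/
theorem OrientedCircuit.chain_left {c : G.OrientedCircuit} {x y : H} {s t : List H}
    (hc : c.toCycle = ↑((x :: s) ++ (y :: t))) (hv : G.vert x = G.vert y) :
    ((x :: s : List H) : Cycle H).Chain fun a b => G.vert (G.opp a) = G.vert b ∧ G.opp a ≠ b := by
  have h1 := c.chain
  rw [hc, List.cons_append, Cycle.chain_coe_cons] at h1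
  have hmem : ∀ a ∈ x :: s, a ∈ c.toCycle := fun a ha => by
    rw [hc, Cycle.mem_coe_iff]
    exact List.mem_append_left _ ha
  have h2 : List.IsChain (fun a b => G.vert (G.opp a) = G.vert b) (x :: s ++ [y]) := by
    have : x :: (s ++ y :: t ++ [x]) = (x :: s ++ [y]) ++ (t ++ [x]) := by simp
    rw [this] at h1
    exact h1.left_of_append
  rw [Cycle.chain_coe_cons, List.isChain_iff_forall_rel_of_append_cons_cons]
  intro a b u u' hu
  have ha : a ∈ x :: s ++ [x] := by rw [List.cons_append, hu]; simp
  have hb : b ∈ x :: s ++ [x] := by rw [List.cons_append, hu]; simp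
  have hsub : ∀ a ∈ x :: s ++ [x], a ∈ c.toCycle := fun a ha => hmem a (by simpa [or_comm, or_assoc] using ha)
  refine ⟨?_, fun e => c.opp_notMem a (hsub a ha) (e ▸ hsub b hb)⟩
  rw [List.isChain_iff_forall_rel_of_append_cons_cons] at h2
  -- At the closing pair the circuit itself would go on to `y`; returning to `x` instead is
  -- legitimate because the two share a vertex.
  rcases List.eq_nil_or_concat u' with rfl | ⟨u'', z, rfl⟩
  · have h3 : (x :: s) ++ [x] = (u ++ [a]) ++ [b] := by simpa using hu
    obtain ⟨h4, h5⟩ := List.append_inj' h3 rfl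
    obtain rfl : x = b := by simpa using h5
    rw [hv]
    exact h2 (l₁ := u) (l₂ := []) (by rw [h4]; simp)
  · have h3 : (x :: s) ++ [x] = (u ++ a :: b :: u'') ++ [z] := by simpa using hu
    obtain ⟨h4, h5⟩ := List.append_inj' h3 rfl
    exact h2 (l₁ := u) (l₂ := u'' ++ [y]) (by rw [h4]; simp)

/-- Rotated to start at `y`, the circuit ends with the last half-edge of `x :: s`, which therefore
arrives where `y` leaves. -/
theorem OrientedCircuit.vert_opp_getLast {c : G.OrientedCircuit} {x y : H} {s t : List H}
    (hc : c.toCycle = ↑((x :: s) ++ (y :: t))) :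
    G.vert (G.opp ((x :: s).getLast (List.cons_ne_nil x s))) = G.vert y := by
  refine OrientedCircuit.Passage.vert_eq (c := c) (OrientedCircuit.passage_iff.2
    ⟨t ++ (x :: s), ?_, ?_⟩)
  · rw [hc, Cycle.coe_eq_coe]
    exact List.isRotated_append (l := x :: s) (l' := y :: t)
  · simp

/-- A circuit of a four-regular graph visits a vertex at most twice. -/
theorem OrientedCircuit.eq_or_eq_of_vert_eq (hG : G.IsFourRegular) {c : G.OrientedCircuit}
    {x y h : H} {s t : List H} (hc : c.toCycle = ↑((x :: s) ++ (y :: t)))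
    (hv : G.vert x = G.vert y) (hh : h ∈ c.toCycle) (hhv : G.vert h = G.vert x) :
    h = x ∨ h = y := by
  have hc' : c.toCycle = ↑((y :: t) ++ (x :: s)) := by
    rw [hc, Cycle.coe_eq_coe]
    exact List.isRotated_append
  have hn := c.nodup
  rw [hc, Cycle.nodup_coe_iff, List.nodup_append] at hn
  obtain ⟨-, -, hn⟩ := hn
  have hu := c.vert_opp_getLast hc
  have hu' := c.vert_opp_getLast hc'
  have hm := List.getLast_mem (List.cons_ne_nil x s)
  have hm' := List.getLast_mem (List.cons_ne_nil y t)
  set z := (x :: s).getLast (List.cons_ne_nil x s)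
  set z' := (y :: t).getLast (List.cons_ne_nil y t)
  have hmem : ∀ a, a ∈ x :: s ∨ a ∈ y :: t → a ∈ c.toCycle := fun a ha => by
    rw [hc, Cycle.mem_coe_iff]
    exact List.mem_append.2 ha
  have hxc := hmem x (by simp)
  have hyc := hmem y (by simp)
  have hzc := hmem z (Or.inl hm)
  have hzc' := hmem z' (Or.inr hm')
  have hxy : x ≠ y := hn x (by simp) y (by simp)
  have hzz : G.opp z ≠ G.opp z' := fun e => hn z hm z' hm' (by
    rw [← G.opp_opp z, e, G.opp_opp])
  have hne : ∀ a b, a ∈ c.toCycle → b ∈ c.toCycle → a ≠ G.opp b := fun a b ha hb e =>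
    c.opp_notMem b hb (e ▸ ha)
  -- Two leaving and two arriving half-edges exhaust the four at this vertex, and `h`, being a
  -- leaving one, cannot be an arriving one.
  have hcard : ({x, y, G.opp z, G.opp z'} : Set H).ncard = 4 := by
    rw [Set.ncard_insert_of_notMem, Set.ncard_insert_of_notMem, Set.ncard_pair hzz]
    · simp [hne y z hyc hzc, hne y z' hyc hzc']
    · simp [hxy, hne x z hxc hzc, hne x z' hxc hzc']
  have hsub : ({x, y, G.opp z, G.opp z'} : Set H) ⊆ {k | G.vert k = G.vert x} := by
    rintro k (rfl | rfl | rfl | rfl)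
    · rfl
    · exact hv.symm
    · exact hu.trans hv.symm
    · exact hu'
  have h4 := hG (G.vert x)
  have heq := Set.eq_of_subset_of_ncard_le hsub (by omega)
    (Set.finite_of_ncard_ne_zero (by omega))
  have hh' : h ∈ ({x, y, G.opp z, G.opp z'} : Set H) := by rw [heq]; exact hhv
  rcases hh' with rfl | rfl | rfl | rfl
  · exact Or.inl rfl
  · exact Or.inr rfl
  · exact absurd rfl (hne _ _ hh hzc)
  · exact absurd rfl (hne _ _ hh hzc')

/-- A fundamental circuit is part of any oriented circuit with the same underlying circuit, up to
reversal. -/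
theorem exists_split_of_toCircuit_eq {c d : G.OrientedCircuit} {v : V} {l l' : List H}
    (hc : c.toCycle = ↑(l ++ l')) (hl : l.head?.map G.vert = some v)
    (hl' : l'.head?.map G.vert = some v) (hd : c.toCircuit = d.toCircuit) :
    ∃ (m : List H) (x : H) (s : List H) (y : H) (t : List H), (m = l ∨ m = (l.map G.opp).reverse) ∧ m = x :: s ∧
      d.toCycle = ((x :: s ++ y :: t : List H) : Cycle H) ∧ G.vert x = v ∧ G.vert y = v := by
  obtain _ | ⟨x, s⟩ := l
  · simp at hl
  obtain _ | ⟨y, t⟩ := l'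
  · simp at hl'
  simp only [List.head?_cons, Option.map_some, Option.some.injEq] at hl hl'
  rcases OrientedCircuit.toCircuit_eq_iff.1 hd with rfl | rfl
  · exact ⟨_, x, s, y, t, Or.inl rfl, rfl, hc, hl, hl'⟩
  · have hu := c.vert_opp_getLast hc
    -- Reversal exchanges the order of the two parts, so they are exchanged beforehand to keep the
    -- reversed `l` in front.
    have hc' : c.toCycle = ↑((y :: t) ++ (x :: s)) := by
      rw [hc, Cycle.coe_eq_coe]
      exact List.isRotated_append
    have hu' := c.vert_opp_getLast hc'
    have key : ∀ (x : H) (s : List H), ∃ s', ((x :: s).map G.opp).reverse =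
        G.opp ((x :: s).getLast (List.cons_ne_nil x s)) :: s' := fun x s => by
      refine ⟨((x :: s).dropLast.map G.opp).reverse, ?_⟩
      conv_lhs => rw [← List.dropLast_append_getLast (List.cons_ne_nil x s)]
      simp
    obtain ⟨s', hs'⟩ := key x s
    obtain ⟨t', ht'⟩ := key y t
    refine ⟨_, _, s', _, t', Or.inr rfl, hs', ?_, hu.trans hl', hu'.trans hl⟩
    rw [← hs', ← ht', OrientedCircuit.toCycle_reverse, hc', Cycle.map_coe, Cycle.reverse_coe,
      List.map_append, List.reverse_append]

end Euler

/-! ### Potentials from partial sums along Euler circuits -/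

section Potential

variable {V E H : Type*} {G : HalfEdgeGraph V E H}

/-- A part of a circuit that misses `a` is an interval of the list obtained by cutting the circuit
open at `a`. -/
theorem exists_segment {a : H} {l m m' : List H} (h : (m ++ m') ~r (a :: l)) (hn : (a :: l).Nodup)
    (ha : a ∉ m) : ∃ u u', l = u ++ m ++ u' ∧ m' = u' ++ a :: u := by
  have ha' : a ∈ m' := by
    have : a ∈ m ++ m' := h.mem_iff.2 (by simp)
    exact (List.mem_append.1 this).resolve_left ha
  obtain ⟨u', u, rfl⟩ := List.append_of_mem ha'
  refine ⟨u, u', List.eq_of_isRotated_cons (a := a) ?_ hn, rfl⟩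
  refine h.symm.trans ?_
  have := List.isRotated_append (l := m ++ u') (l' := a :: u)
  simpa using this

/-- If a function on the half-edges of a circuit adds up to zero along one closed part of the circuit
at every vertex, then it is a coboundary away from the half-edge that all these parts avoid. -/
theorem OrientedCircuit.exists_potential (hG : G.IsFourRegular) {R : Type*} [AddCommGroup R]
    {c : G.OrientedCircuit} {a : H} {l : List H} (hc : c.toCycle = ((a :: l : List H) : Cycle H))
    {τ : H → R} (hτ : ∀ h ∈ c.toCycle, ∃ (x : H) (s : List H) (y : H) (t : List H),
      c.toCycle = ((x :: s ++ y :: t : List H) : Cycle H) ∧ G.vert x = G.vert h ∧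
        G.vert y = G.vert h ∧ a ∉ x :: s ∧ ((x :: s).map τ).sum = 0) :
    ∃ p : V → R, ∀ h ∈ c.toCycle, h ≠ a → τ h = p (G.vert (G.opp h)) - p (G.vert h) := by
  classical
  have hn := c.nodup
  rw [hc, Cycle.nodup_coe_iff] at hn
  have hn' : (l ++ [a]).Nodup := by
    rw [List.nodup_cons] at hn
    exact hn.2.append (by simp) (by simpa using hn.1)
  have hmem : ∀ h, h ∈ c.toCycle ↔ h ∈ l ++ [a] := fun h => by
    rw [hc, Cycle.mem_coe_iff]
    simp [or_comm]
  -- The sum of `τ` strictly before `h`, starting just after `a`. Placing `a` last gives every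
  -- half-edge of `l` a successor.
  let q : H → R := fun h => (((l ++ [a]).takeWhile (fun x => x ≠ h)).map τ).sum
  have hq : ∀ u h u', l ++ [a] = u ++ h :: u' → q h = (u.map τ).sum := by
    intro u h u' e
    have hu : h ∉ u := by
      rw [e, List.nodup_append] at hn'
      exact fun hh => hn'.2.2 h hh h (by simp) rfl
    simp only [q]
    rw [e, List.takeWhile_ne_eq_of_append hu]
  have hcons : ∀ u' : List H, ∃ h u'', u' ++ [a] = h :: u'' := by
    intro u'
    cases u' with
    | nil => exact ⟨a, [], rfl⟩
    | cons b u' => exact ⟨b, u' ++ [a], rfl⟩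
  have hconst : ∀ h ∈ c.toCycle, ∀ h' ∈ c.toCycle, G.vert h = G.vert h' → q h = q h' := by
    intro h hh h' hh' hv
    obtain ⟨x, s, y, t, hcyc, hx, hy, ha, hsum⟩ := hτ h hh
    have hrot : (x :: s ++ y :: t) ~r (a :: l) := Cycle.coe_eq_coe.1 (hcyc.symm.trans hc)
    obtain ⟨u, u', hl, ht⟩ := exists_segment hrot hn ha
    have hxy : q x = q y := by
      rw [hq u x (s ++ u' ++ [a]) (by simp [hl])]
      obtain ⟨z, u'', hz⟩ := hcons u'
      -- The half-edge after the closed part is `y`, possibly `a` itself, so `q y` exceeds `q x` by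
      -- the sum over that part, which is zero.
      have hyz : y = z := by
        have : u' ++ a :: u = z :: (u'' ++ u) := by
          rw [← List.cons_append, ← hz]; simp
        rw [this] at ht
        exact (List.cons.inj ht).1
      rw [hq (u ++ x :: s) y u'' (by rw [hl, hyz, List.append_assoc _ u', hz]),
        List.map_append, List.sum_append, hsum, add_zero]
    have hxy' : ∀ k ∈ c.toCycle, G.vert k = G.vert h → q k = q x := by
      intro k hk hkv
      rcases c.eq_or_eq_of_vert_eq hG hcyc (hx.trans hy.symm) hk (hkv.trans hx.symm) with rfl | rfl
      · rfl
      · exact hxy.symm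
    rw [hxy' h hh rfl, hxy' h' hh' hv.symm]
  -- The default 0 is never consulted: only vertices visited by `c` matter.
  let p : V → R := fun v => if hv : ∃ h ∈ c.toCycle, G.vert h = v then q hv.choose else 0
  have hp : ∀ h ∈ c.toCycle, p (G.vert h) = q h := by
    intro h hh
    have hv : ∃ k ∈ c.toCycle, G.vert k = G.vert h := ⟨h, hh, rfl⟩
    simp only [p]
    rw [dif_pos hv]
    exact hconst _ hv.choose_spec.1 _ hh hv.choose_spec.2
  refine ⟨p, fun h hh hne => ?_⟩
  have hhl : h ∈ l := by
    have := (hmem h).1 hh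
    simpa [hne] using this
  obtain ⟨u, u', hl⟩ := List.append_of_mem hhl
  obtain ⟨z, u'', hz⟩ := hcons u'
  have hl' : l ++ [a] = u ++ h :: z :: u'' := by rw [hl, ← hz]; simp
  have hzc : z ∈ c.toCycle := by rw [hmem, hl']; simp
  have hch := c.chain
  rw [hc, Cycle.chain_coe_cons, List.isChain_iff_forall_rel_of_append_cons_cons] at hch
  have hv : G.vert (G.opp h) = G.vert z :=
    hch (l₁ := a :: u) (l₂ := u'') (by rw [hl']; simp)
  rw [hv, hp z hzc, hp h hh, hq u h _ hl', hq (u ++ [h]) z u'' (by rw [hl']; simp)]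
  simp

theorem sum_map_opp_reverse {R : Type*} [AddCommGroup R] {τ : H → R}
    (hτ : ∀ h, τ (G.opp h) = -τ h) (l : List H) :
    (((l.map G.opp).reverse).map τ).sum = -(l.map τ).sum := by
  induction l with
  | nil => simp
  | cons a l ih =>
    simp only [List.map_cons, List.reverse_cons, List.map_append, List.sum_append, ih, hτ,
      List.map_nil, List.sum_cons, List.sum_nil]
    abel

variable {C : Set G.Circuit} {B : Set E} {Γ : V → List H}

/-- An antisymmetric function on the half-edges that adds up to zero along a based set of fundamental
circuits is a coboundary away from the base edges. -/
theorem IsBasedAt.exists_potential (hG : G.IsFourRegular) (hC : G.IsEulerSystem C)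
    (hB : G.IsBaseEdgeSet B) (hΓ : G.IsBasedAt C B Γ) {R : Type*} [AddCommGroup R] {τ : H → R}
    (hτ : ∀ h, τ (G.opp h) = -τ h) (hsum : ∀ v, ((Γ v).map τ).sum = 0) :
    ∃ p : V → R, ∀ h, G.edge h ∉ B → τ h = p (G.vert (G.opp h)) - p (G.vert h) := by
  have key : ∀ K : G.Component, ∃ p : V → R, ∀ h, G.componentOf h = K → G.edge h ∉ B →
      τ h = p (G.vert (G.opp h)) - p (G.vert h) := by
    intro K
    obtain ⟨_, ⟨he, a, rfl, haK⟩, hBuniq⟩ := hB K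
    obtain ⟨γ, ⟨hγC, hγ⟩, hγuniq⟩ := hC.2 K
    obtain ⟨c, a', rfl, ha', he', hea⟩ : ∃ (c : G.OrientedCircuit) (a' : H), c.toCircuit = γ ∧
        a' ∈ c.toCycle ∧ G.edge a' ∈ B ∧ G.edge a' = G.edge a := by
      obtain ⟨c, hc, a', h1, h2⟩ := (hγ a).2 haK
      exact ⟨c, a', hc, h1, h2 ▸ he, h2⟩
    obtain ⟨l, hl⟩ := OrientedCircuit.exists_coe_eq ha'
    have hpart : ∀ h ∈ c.toCycle, ∃ (x : H) (s : List H) (y : H) (t : List H),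
        c.toCycle = ((x :: s ++ y :: t : List H) : Cycle H) ∧ G.vert x = G.vert h ∧
          G.vert y = G.vert h ∧ a' ∉ x :: s ∧ ((x :: s).map τ).sum = 0 := by
      intro h hh
      obtain ⟨⟨d, l', hdC, hd, hh1, hh2⟩, hΓB⟩ := hΓ (G.vert h)
      have hhK : G.componentOf h = K := (hγ h).1 (Circuit.edge_mem_edges hh)
      -- The circuit carrying `Γ (G.vert h)` meets the component `K`, whose Euler circuit in `C` is
      -- unique.
      have hdc : d.toCircuit = c.toCircuit := by
        obtain ⟨K', hK'⟩ := hC.1 _ hdC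
        obtain ⟨z, hz, hzv⟩ : ∃ z ∈ Γ (G.vert h), G.vert z = G.vert h := by
          cases hs : Γ (G.vert h) with
          | nil => simp [hs] at hh1
          | cons z s => exact ⟨z, by simp, by simpa [hs] using hh1⟩
        have hzd : z ∈ d.toCycle := by
          rw [hd, Cycle.mem_coe_iff]
          exact List.mem_append_left _ hz
        have hzK : G.componentOf z = K' := (hK' z).1 (Circuit.edge_mem_edges hzd)
        have : K' = K := by rw [← hzK, ← hhK, componentOf_eq_of_vert_eq hzv]
        subst this
        exact hγuniq _ ⟨hdC, hK'⟩
      obtain ⟨m, x, s, y, t, hm, hmx, hcyc, hx, hy⟩ := exists_split_of_toCircuit_eq hd hh1 hh2 hdc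
      refine ⟨x, s, y, t, hcyc, hx, hy, ?_, ?_⟩
      · rw [← hmx]
        rcases hm with rfl | rfl
        · exact fun h' => hΓB _ h' he'
        · intro h'
          rw [List.mem_reverse, List.mem_map] at h'
          obtain ⟨b, hb, rfl⟩ := h'
          exact hΓB _ hb (G.edge_opp b ▸ he')
      · rw [← hmx]
        rcases hm with rfl | rfl
        · exact hsum _
        · rw [sum_map_opp_reverse hτ, hsum, neg_zero]
    obtain ⟨p, hp⟩ := OrientedCircuit.exists_potential hG hl hpart
    refine ⟨p, fun h hhK hhB => ?_⟩
    rcases OrientedCircuit.mem_or_opp_mem_of_edge_mem ((hγ h).2 hhK) with hh | hh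
    · exact hp h hh fun e => hhB (e ▸ he')
    -- Here `c` traverses the edge the other way; antisymmetry of `τ` transfers the formula.
    · have := hp _ hh fun e => hhB (by rw [← G.edge_opp, e]; exact he')
      rw [G.opp_opp, hτ, neg_eq_iff_eq_neg, neg_sub] at this
      exact this
  choose p hp using key
  -- The potentials of the components glue because no edge joins two components.
  refine ⟨fun v => p (G.underlying.connectedComponentMk v) v, fun h hh => ?_⟩
  have := hp (G.componentOf h) h rfl hh
  have h2 := componentOf_opp (G := G) h
  simp only [componentOf] at this h2
  simp only [h2]
  exact this

theorem IsBasedAt.isChain (hΓ : G.IsBasedAt C B Γ) (v : V) :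
    ((Γ v : List H) : Cycle H).Chain fun a b => G.vert (G.opp a) = G.vert b ∧ G.opp a ≠ b := by
  obtain ⟨⟨c, l', -, hc, h1, h2⟩, -⟩ := hΓ v
  generalize Γ v = l at hc h1
  obtain _ | ⟨x, s⟩ := l
  · trivial
  obtain _ | ⟨y, t⟩ := l'
  · simp at h2
  simp only [List.head?_cons, Option.map_some, Option.some.injEq] at h1 h2
  exact OrientedCircuit.chain_left hc (h1.trans h2.symm)

end Potential

/-! ### Kernel vectors and coboundaries of the touch-graph -/

section Main

variable {V E H : Type*} {G : HalfEdgeGraph V E H} {C : Set G.Circuit} {B : Set E} {Γ : V → List H}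

namespace CircuitPartition

variable (P : G.CircuitPartition)

theorem componentOf_eq_of_circuitOf_eq {h k : H} (hk : P.circuitOf h = P.circuitOf k) :
    G.componentOf h = G.componentOf k :=
  P.eq_of_circuitOf_eq componentOf_opp (fun h => componentOf_eq_of_vert_eq (P.vert_partner h)) hk

/-- A function on the half-edges that respects the single transitions, and respects all edges but
one edge of each component, respects all edges. -/
theorem apply_opp_eq_of_base (hB : G.IsBaseEdgeSet B) {R : Type*} [AddCommGroup R] {g : H → R}
    (h1 : ∀ h, g (P.partner h) = g h) (h2 : ∀ h, G.edge h ∉ B → g (G.opp h) = g h) (h : H) :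
    g (G.opp h) = g h := by
  by_cases hh : G.edge h ∈ B
  swap
  · exact h2 h hh
  obtain ⟨c, hc, hhc⟩ := P.exists_oriented h
  obtain ⟨l, hl⟩ := OrientedCircuit.exists_coe_eq hhc
  have hch := P.pairs_chain hc
  have hn := c.nodup
  have hmem : ∀ k ∈ l, k ∈ c.toCycle := fun k hk => by
    rw [hl, Cycle.mem_coe_iff]
    exact List.mem_cons_of_mem _ hk
  rw [hl] at hch hn
  rw [Cycle.nodup_coe_iff, List.nodup_cons] at hn
  -- The half-edge after `a` is the partner of `opp a`, where `g` has the same value, so the two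
  -- sums around the circuit agree.
  have hs := Cycle.Chain.sum_map_eq (φ := fun a => g (G.opp a)) (ψ := g)
    (hch.imp fun a b e => by rw [e, h1])
  have hl' : l.map (fun a => g (G.opp a)) = l.map g := by
    -- The circuit stays in one component, so `h` carries its only base edge; all other terms agree
    -- and the terms at `h` are left.
    refine List.map_congr_left fun k hk => h2 k fun hkB => ?_
    have hK : G.componentOf k = G.componentOf h := P.componentOf_eq_of_circuitOf_eq (by
      rw [P.circuitOf_eq hc (Circuit.edge_mem_edges (hmem k hk)),
        P.circuitOf_eq hc (Circuit.edge_mem_edges hhc)])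
    have he := (hB (G.componentOf h)).unique ⟨hkB, k, rfl, hK⟩ ⟨hh, h, rfl, rfl⟩
    rcases G.eq_or_eq_opp he with rfl | rfl
    · exact hn.1 hk
    · exact c.opp_notMem h hhc (hmem _ hk)
  rw [List.map_cons, List.map_cons, List.sum_cons, List.sum_cons, hl'] at hs
  exact add_right_cancel hs

variable {hG : G.IsFourRegular} (D : (P.touchGraph hG).Direction)

/-- A vector that is orthogonal to the shadows of a based set of fundamental circuits is a
coboundary of the touch-graph. -/
theorem exists_coboundary_eq [Fintype V] (hC : G.IsEulerSystem C) (hB : G.IsBaseEdgeSet B)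
    (hΓ : G.IsBasedAt C B Γ) {R : Type*} [CommRing R] {x : V → R}
    (hx : ∀ v, ∑ w, (P.touchGraph hG).tally D R (P.shadow (Γ v)) w * x w = 0) :
    ∃ f, coboundary D R f = x := by
  obtain ⟨p, hp⟩ := hΓ.exists_potential hG hC hB
    (τ := fun h => P.level D x h - P.level D x (G.opp h))
    (fun h => by rw [G.opp_opp, neg_sub])
    (fun v => by rw [← P.sum_tally_shadow_mul D x (hΓ.isChain v), hx])
  -- The potential compensates exactly for the change of level across a non-base edge.
  let g : H → R := fun h => P.level D x h + p (G.vert h)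
  have h1 : ∀ h, g (P.partner h) = g h := fun h => by
    simp only [g, P.level_partner, P.vert_partner]
  have h2 : ∀ h, g (G.opp h) = g h := P.apply_opp_eq_of_base hB h1 fun h hh => by
    have := hp h hh
    simp only [g]
    rw [sub_eq_sub_iff_add_eq_add] at this
    rw [add_comm, ← this]
  have hs := Function.surjInv_eq P.circuitOf_surjective
  refine ⟨fun γ => g (Function.surjInv P.circuitOf_surjective γ), ?_⟩
  have hg : ∀ h, g (Function.surjInv P.circuitOf_surjective (P.circuitOf h)) = g h := fun h =>
    P.eq_of_circuitOf_eq h2 h1 (hs _)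
  ext v
  -- The two ends of the edge of `v` are lifted to half-edges at `v`; in the difference of `g` the
  -- terms `p v` cancel, leaving the levels `x v` and 0.
  obtain ⟨a, ha⟩ : ∃ a, P.proj a = D.init v := Quotient.exists_rep _
  obtain ⟨b, hb⟩ : ∃ b, P.proj b = (P.touchGraph hG).opp (D.init v) := Quotient.exists_rep _
  have hav : G.vert a = v := by rw [← P.touchGraph_edge hG, ha, D.edge_init]
  have hbv : G.vert b = v := by
    rw [← P.touchGraph_edge hG, hb, (P.touchGraph hG).edge_opp, D.edge_init]
  change g (Function.surjInv _ _) - g (Function.surjInv _ _) = x v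
  rw [← hb, ← ha, P.touchGraph_vert, P.touchGraph_vert, hg, hg]
  have hne : P.proj b ≠ D.init v := hb ▸ (P.touchGraph hG).opp_ne _
  have hla : P.level D x a = 0 := if_pos (by rw [ha, hav])
  have hlb : P.level D x b = x v := by rw [level, hbv, if_neg hne]
  simp only [g, hla, hlb, hav, hbv]
  ring

/-- The component in which a circuit of the partition lies. -/
noncomputable def componentOfCircuit (γ : P.circuits) : G.Component :=
  G.componentOf (Function.surjInv P.circuitOf_surjective γ)

theorem componentOfCircuit_circuitOf (h : H) :
    P.componentOfCircuit (P.circuitOf h) = G.componentOf h :=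
  P.componentOf_eq_of_circuitOf_eq (Function.surjInv_eq P.circuitOf_surjective _)

theorem componentOfCircuit_surjective (hG : G.IsFourRegular) : Function.Surjective P.componentOfCircuit := by
  intro K
  induction K using SimpleGraph.ConnectedComponent.ind with
  | h v =>
    obtain ⟨h, rfl⟩ := hG.exists_vert_eq v
    exact ⟨P.circuitOf h, P.componentOfCircuit_circuitOf h⟩

/-- The functions with coboundary zero are those that are constant on components. -/
theorem ker_coboundary (R : Type*) [CommRing R] :
    LinearMap.ker (coboundary D R) = LinearMap.range (LinearMap.funLeft R R P.componentOfCircuit) := by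
  classical
  ext f
  rw [LinearMap.mem_ker, LinearMap.mem_range]
  constructor
  · intro hf
    -- Equal values at the two ends of each touch-graph edge make `f` a function of the vertices of
    -- `G`, and it is constant along the edges of `G`.
    have hv : ∀ h k, G.vert h = G.vert k → f (P.circuitOf h) = f (P.circuitOf k) := by
      intro h k hhk
      have hz := coboundary_edge D f (P.proj h)
      rw [hf] at hz
      simp only [Pi.zero_apply, neg_zero, ite_self] at hz
      rcases (P.touchGraph hG).eq_or_eq_opp (h := P.proj h) (k := P.proj k) hhk.symm with e | e
      · rw [← P.touchGraph_vert hG, ← P.touchGraph_vert hG, e]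
      · rw [← P.touchGraph_vert hG, ← P.touchGraph_vert hG, e]
        exact (sub_eq_zero.1 hz.symm).symm
    choose s hs using hG.exists_vert_eq
    have hs' : ∀ h, f (P.circuitOf (s (G.vert h))) = f (P.circuitOf h) := fun h => hv _ _ (hs _)
    have hK : ∀ h k, G.componentOf h = G.componentOf k → f (P.circuitOf h) = f (P.circuitOf k) := by
      intro h k e
      rw [← hs' h, ← hs' k]
      exact eq_of_componentMk_eq (f := fun v => f (P.circuitOf (s v)))
        (fun h => by rw [hs', hs', P.circuitOf_opp]) e
    refine ⟨fun K => f (Function.surjInv (P.componentOfCircuit_surjective hG) K), ?_⟩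
    ext γ
    obtain ⟨h, rfl⟩ := P.circuitOf_surjective γ
    rw [LinearMap.funLeft_apply]
    obtain ⟨k, hk⟩ := P.circuitOf_surjective (Function.surjInv
      (P.componentOfCircuit_surjective hG) (P.componentOfCircuit (P.circuitOf h)))
    rw [← hk]
    apply hK
    rw [← P.componentOfCircuit_circuitOf, hk,
      Function.surjInv_eq (P.componentOfCircuit_surjective hG), P.componentOfCircuit_circuitOf]
  · rintro ⟨f, rfl⟩
    have hf : ∀ h, LinearMap.funLeft R R P.componentOfCircuit f ((P.touchGraph hG).vert (P.proj h)) =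
        f (G.componentOf h) := fun h => by
      rw [LinearMap.funLeft_apply, P.touchGraph_vert, P.componentOfCircuit_circuitOf]
    ext v
    obtain ⟨a, ha⟩ : ∃ a, P.proj a = D.init v := Quotient.exists_rep _
    obtain ⟨b, hb⟩ : ∃ b, P.proj b = (P.touchGraph hG).opp (D.init v) := Quotient.exists_rep _
    have hab : G.vert b = G.vert a := by
      rw [← P.touchGraph_edge hG, ← P.touchGraph_edge hG, hb, ha, (P.touchGraph hG).edge_opp]
    change LinearMap.funLeft R R P.componentOfCircuit f _ -
      LinearMap.funLeft R R P.componentOfCircuit f _ = 0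
    rw [← hb, ← ha, hf, hf, componentOf_eq_of_vert_eq hab, sub_self]

/-- Rank-nullity: every component contains a circuit of P, so the kernel is a faithful copy of the
functions on components. -/
theorem finrank_range_coboundary [Finite V] (𝕜 : Type*) [Field 𝕜] :
    (Module.finrank 𝕜 (LinearMap.range (coboundary D 𝕜)) : ℤ) =
      (P.circuits.ncard : ℤ) - (Nat.card G.Component : ℤ) := by
  have := hG.finite_half
  have : Finite P.circuits := Finite.of_surjective _ P.circuitOf_surjective
  have : Fintype P.circuits := Fintype.ofFinite _
  have hsurj := P.componentOfCircuit_surjective hG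
  have : Finite G.Component := Finite.of_surjective _ hsurj
  have : Fintype G.Component := Fintype.ofFinite _
  have h1 := LinearMap.finrank_range_add_finrank_ker (coboundary D 𝕜)
  rw [P.ker_coboundary D, LinearMap.finrank_range_of_inj
    (LinearMap.funLeft_injective_of_surjective 𝕜 𝕜 _ hsurj), Module.finrank_fintype_fun_eq_card,
    Module.finrank_fintype_fun_eq_card, ← Nat.card_eq_fintype_card, ← Nat.card_eq_fintype_card,
    Nat.card_coe_set_eq] at h1
  omega

end CircuitPartition

end Main

end HalfEdgeGraph

/-! ### Orthogonality and the row space -/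

/-- A vector orthogonal to the kernel of a matrix is in the row space. -/
theorem Matrix.mem_span_range_row {m n 𝕜 : Type*} [Fintype n] [Field 𝕜] {M : Matrix m n 𝕜}
    {y : n → 𝕜} (hy : ∀ x, M.mulVec x = 0 → ∑ i, y i * x i = 0) :
    y ∈ Submodule.span 𝕜 (Set.range M.row) := by
  classical
  by_contra hn
  obtain ⟨f, hf, hle⟩ := Submodule.exists_le_ker_of_notMem hn
  -- The functional that separates `y` from the rows is the dot product with its values on the
  -- standard basis, and this vector lies in the kernel.
  have hdot : ∀ z, f z = ∑ i, z i * f (Pi.single i 1) := fun z => by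
    conv_lhs => rw [pi_eq_sum_univ' z]
    simp
  refine hf ((hdot y).trans (hy _ ?_))
  ext i
  exact (hdot (M.row i)).symm.trans (hle (Submodule.subset_span ⟨i, rfl⟩))

theorem mainTheorem6 {V E H : Type*} [Fintype V] (F : HalfEdgeGraph V E H)
    (hF : F.IsFourRegular)
    (C : Set F.Circuit) (hC : F.IsEulerSystem C)
    (B : Set E) (hB : F.IsBaseEdgeSet B)
    (Γ : V → List H) (hΓ : F.IsBasedAt C B Γ)
    (P : F.CircuitPartition) (D : (P.touchGraph hF).Direction)
    (𝕜 : Type*) [Field 𝕜] :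
    Submodule.span 𝕜 (Set.range ((P.circuitMatrix hF D Γ).map (Int.cast : ℤ → 𝕜)).row) =
        (P.touchGraph hF).cycleSpace D 𝕜 ∧
      (Module.finrank 𝕜
          (LinearMap.ker ((P.circuitMatrix hF D Γ).map (Int.cast : ℤ → 𝕜)).mulVecLin) : ℤ) =
        (P.circuits.ncard : ℤ) - (Nat.card F.Component : ℤ) := by
  set M := (P.circuitMatrix hF D Γ).map (Int.cast : ℤ → 𝕜) with hM
  have hrow : ∀ v, M.row v = (P.touchGraph hF).tally D 𝕜 (P.shadow (Γ v)) := fun v => by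
    ext w
    exact HalfEdgeGraph.intCast_tally D 𝕜 _ w
  have hclosed : ∀ v, (P.touchGraph hF).IsClosedWalk (P.shadow (Γ v)) := fun v =>
    P.isClosedWalk_shadow hF (hΓ.isChain v)
  have hmul : ∀ x v, M.mulVec x v =
      ∑ w, (P.touchGraph hF).tally D 𝕜 (P.shadow (Γ v)) w * x w := fun x v => by
    rw [← hrow]
    rfl
  have hker : LinearMap.ker M.mulVecLin =
      LinearMap.range (HalfEdgeGraph.coboundary D 𝕜) := by
    ext x
    rw [LinearMap.mem_ker, Matrix.mulVecLin_apply, LinearMap.mem_range]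
    constructor
    · intro hx
      exact P.exists_coboundary_eq D hC hB hΓ fun v => by rw [← hmul, hx, Pi.zero_apply]
    · rintro ⟨f, rfl⟩
      ext v
      rw [hmul, (hclosed v).sum_tally_mul_coboundary, Pi.zero_apply]
  refine ⟨le_antisymm (Submodule.span_le.2 ?_) (Submodule.span_le.2 ?_), ?_⟩
  · rintro _ ⟨v, rfl⟩
    exact Submodule.subset_span ⟨_, hclosed v, (hrow v).symm⟩
  · rintro _ ⟨w, hw, rfl⟩
    -- No basis of the cycle space is needed: each closed walk is orthogonal to all coboundaries,
    -- hence to the kernel.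
    refine Matrix.mem_span_range_row fun x hx => ?_
    obtain ⟨f, rfl⟩ : x ∈ LinearMap.range (HalfEdgeGraph.coboundary D 𝕜) := by
      rw [← hker, LinearMap.mem_ker, Matrix.mulVecLin_apply, hx]
    exact hw.sum_tally_mul_coboundary D f
  · rw [hker, P.finrank_range_coboundary D]
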